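/- Let $M$ be a (Hausdorff) complex manifold of dimension $n$, and let $PSH^{cb}(M)$ be the set of all plurisubharmonic functions $u : M \to [-\infty,\infty)$ that are continuous (as maps into $[-\infty,\infty]$) and bounded above. For $w_0 \in M$ put \[A^{cb}(w_0) = \{z \in M : u(z) \le u(w_0) \text{ for every } u \in PSH^{cb}(M)\}.\] If $A^{cb}(w_0) \ne \{w_0\}$, then $A^{cb}(w_0)$ is $1$-pseudoconcave in the sense of Rothstein. That is, $A^{cb}(w_0)$ is closed in $M$ and, for every $z_0 \in A^{cb}(w_0)$, every open neighborhood $V$ of $z_0$, every strictly plurisubharmonic function $\rho : V \to \mathbb{R}$ (of class $C^2$, with positive definite Levi form at each point of $V$) and every neighborhood $U$ of $z_0$ whose closure is compact and contained in $V$, there is a point $z \in A^{cb}(w_0) \cap U$ with $\rho(z) > \rho(z_0)$. -/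

import Mathlib

open Set Filter Topology MeasureTheory
open scoped Manifold ContDiff

noncomputable section

namespace CplxMfd

/-- The mean `(1 / 2π) ∫₀^{2π} f(θ) dθ` of a function with values in `[-∞, ∞]`, as the mean of the
positive part minus the mean of the negative part. For a measurable `f` that is bounded above the
first term is finite, so this is the Lebesgue integral with values in `[-∞, ∞)`. -/
def circleMean (f : ℝ → EReal) : EReal :=
  ((⨍⁻ θ in Ioc 0 (2 * Real.pi), (f θ).toENNReal ∂volume : ENNReal) : EReal) -
    ((⨍⁻ θ in Ioc 0 (2 * Real.pi), (-f θ).toENNReal ∂volume : ENNReal) : EReal)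

/-- `f` is plurisubharmonic on the open subset `Ω` of a complex vector space: it is upper
semicontinuous with values in `[-∞, ∞)`, and its restriction to every complex line is subharmonic,
i.e. satisfies the (local) sub-mean value inequality on all sufficiently small circles around every
point. The function that is identically `-∞` is admitted. -/
structure IsPSHOn {E : Type*} [NormedAddCommGroup E] [NormedSpace ℂ E]
    (f : E → EReal) (Ω : Set E) : Prop where
  usc : UpperSemicontinuousOn f Ω
  ne_top : ∀ p ∈ Ω, f p ≠ ⊤
  submean : ∀ p ∈ Ω, ∀ v : E, ∀ᶠ r : ℝ in 𝓝[>] 0,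
    f p ≤ circleMean fun θ => f (p + circleMap 0 r θ • v)

/-- The Levi form `∑ ∂²g/∂z_j∂z̄_k (p) v_j v̄_k` of a real function `g` at `p` in the direction `v`,
written through the real second derivative as `(D²g(p)(v, v) + D²g(p)(iv, iv)) / 4`. -/
def leviForm {E : Type*} [NormedAddCommGroup E] [NormedSpace ℂ E]
    (g : E → ℝ) (p v : E) : ℝ :=
  (fderiv ℝ (fderiv ℝ g) p v v +
    fderiv ℝ (fderiv ℝ g) p (Complex.I • v) (Complex.I • v)) / 4

/-- `g` is strictly plurisubharmonic on the open set `Ω`: it is of class `C²` there, with positive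
definite Levi form at every point. -/
def IsStrictPSHOn {E : Type*} [NormedAddCommGroup E] [NormedSpace ℂ E]
    (g : E → ℝ) (Ω : Set E) : Prop :=
  ContDiffOn ℝ 2 g Ω ∧ ∀ p ∈ Ω, ∀ v : E, v ≠ 0 → 0 < leviForm g p v

section Manifold

variable (n : ℕ) {M : Type*} [TopologicalSpace M] [ChartedSpace (EuclideanSpace ℂ (Fin n)) M]

/-- `PSH(M)`: functions that are plurisubharmonic in all charts. -/
def PSH : Set (M → EReal) :=
  {u | ∀ e ∈ atlas (EuclideanSpace ℂ (Fin n)) M, IsPSHOn (u ∘ e.symm) e.target}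

/-- `PSH^b(M)`: plurisubharmonic functions that are bounded above. -/
def PSHb : Set (M → EReal) := {u | u ∈ PSH n ∧ ∃ C : ℝ, ∀ z, u z ≤ (C : EReal)}

/-- `PSH^c(M)`: plurisubharmonic functions that are continuous, as maps to `[-∞, ∞]`. -/
def PSHc : Set (M → EReal) := {u | u ∈ PSH n ∧ Continuous u}

/-- `PSH^{cb}(M)`, the intersection of `PSH^b(M)` and `PSH^c(M)`. -/
def PSHcb : Set (M → EReal) := PSHb n ∩ PSHc n

/-- The set `A^{cb}(w₀)`. -/
def Acb (w₀ : M) : Set M := {z | ∀ u ∈ PSHcb n (M := M), u z ≤ u w₀}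

/-- `ρ`, of which only the values on the open set `V` matter, is strictly plurisubharmonic on `V`:
it is so in all charts. -/
def StrictPSHOn (ρ : M → ℝ) (V : Set M) : Prop :=
  ∀ e ∈ atlas (EuclideanSpace ℂ (Fin n)) M,
    IsStrictPSHOn (ρ ∘ e.symm) (e.target ∩ e.symm ⁻¹' V)

/-- `A` is `1`-pseudoconcave in the sense of Rothstein. The conditions on `closure U` say that `U`
is relatively compact in `V`. -/
def IsRothsteinPseudoconcave (A : Set M) : Prop :=
  IsClosed A ∧ ∀ z₀ ∈ A, ∀ V : Set M, IsOpen V → z₀ ∈ V → ∀ ρ : M → ℝ, StrictPSHOn n ρ V →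
    ∀ U ∈ 𝓝 z₀, IsCompact (closure U) → closure U ⊆ V → ∃ z ∈ A ∩ U, ρ z₀ < ρ z

end Manifold

end CplxMfd

end

/-! Write A for A^{cb}(w₀) and suppose that ρ has a local maximum along A at z₀ ∈ A. In a chart ball
around q, the image of z₀, the function g = ρ − ρ(z₀) − k‖x − q‖² + δ is still strictly
plurisubharmonic for small k > 0. It equals δ > 0 at q, and for small δ it is negative on A in the
outer shell of the ball. The part of the shell where g ≥ 0 is compact and misses A. Hence some
bounded continuous plurisubharmonic u ≥ 0 that vanishes on A exceeds g there
(`exists_isContPSH_gt_of_isCompact`). So max(u, g) glues with u to a competitor v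
(`IsContPSH.exists_glue_max`) with v(z₀) = δ and v = 0 on A outside the ball.

If z₀ ≠ w₀, the ball is chosen to avoid w₀, and v(z₀) > v(w₀) contradicts z₀ ∈ A. If z₀ = w₀, a
second point p ∈ A is needed and this inequality points the wrong way. But v = g is strictly
plurisubharmonic near z₀, so its value there can be lowered by any amount without changing v
elsewhere than in a small ball (`IsContPSH.exists_dip`). The result is negative at w₀ and zero at p,
contradicting p ∈ A.

Plurisubharmonicity of the glued functions is checked by touching (`isContPSH_of_touching`): the
sub-mean value inequality at a point is inherited from any local minorant that has it and agrees
there. The minorants are strictly plurisubharmonic functions, handled by Taylor's formula, and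
logarithms of moduli of holomorphic functions. -/

namespace CplxMfd

/-! ### Sub-mean value inequalities on small circles in the plane. -/

/-- The local sub-mean value inequality at the origin of the complex plane. -/
def LocSubmean (f : ℂ → ℝ) : Prop :=
  ∀ᶠ r : ℝ in 𝓝[>] 0, f 0 ≤ Real.circleAverage f 0 r

/-- Continuity at all points of a neighbourhood of the origin. -/
def ContNear {X : Type*} [TopologicalSpace X] (f : ℂ → X) : Prop :=
  ∀ᶠ ζ in 𝓝 (0 : ℂ), ContinuousAt f ζ

theorem eventually_closedBall_of_eventually_nhds_zero {P : ℂ → Prop} (h : ∀ᶠ ζ in 𝓝 0, P ζ) :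
    ∀ᶠ r : ℝ in 𝓝[>] 0, ∀ ζ ∈ Metric.closedBall (0 : ℂ) r, P ζ := by
  obtain ⟨ε, hε, h⟩ := Metric.eventually_nhds_iff_ball.1 h
  filter_upwards [Ioo_mem_nhdsGT hε] with r hr ζ hζ
  exact h ζ (Metric.closedBall_subset_ball hr.2 hζ)

theorem eventually_sphere_of_eventually_nhds_zero {P : ℂ → Prop} (h : ∀ᶠ ζ in 𝓝 0, P ζ) :
    ∀ᶠ r : ℝ in 𝓝[>] 0, ∀ ζ ∈ Metric.sphere (0 : ℂ) |r|, P ζ := by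
  filter_upwards [eventually_closedBall_of_eventually_nhds_zero h, self_mem_nhdsWithin]
    with r hr h0 ζ hζ
  rw [abs_of_pos h0] at hζ
  exact hr ζ (Metric.sphere_subset_closedBall hζ)

theorem ContNear.circleIntegrable {f : ℂ → ℝ} (hf : ContNear f) :
    ∀ᶠ r : ℝ in 𝓝[>] 0, CircleIntegrable f 0 r := by
  filter_upwards [eventually_sphere_of_eventually_nhds_zero hf] with r hr
  exact ContinuousOn.circleIntegrable' fun ζ hζ => (hr ζ hζ).continuousWithinAt

/-- The chain f 0 = g 0 ≤ mean of g ≤ mean of f. Only the centre needs equality, so a different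
minorant may be used at every point. -/
theorem LocSubmean.of_minorant {f g : ℂ → ℝ} (hg : LocSubmean g) (cg : ContNear g)
    (cf : ContNear f) (hle : ∀ᶠ ζ in 𝓝 0, g ζ ≤ f ζ) (h0 : f 0 = g 0) : LocSubmean f := by
  filter_upwards [hg, cg.circleIntegrable, cf.circleIntegrable,
    eventually_sphere_of_eventually_nhds_zero hle] with r h1 h2 h3 h4
  rw [h0]
  exact h1.trans (Real.circleAverage_mono h2 h3 h4)

theorem locSubmean_const (a : ℝ) : LocSubmean fun _ => a :=
  Eventually.of_forall fun r => by rw [Real.circleAverage_const]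

theorem LocSubmean.add {f g : ℂ → ℝ} (hf : LocSubmean f) (hg : LocSubmean g) (cf : ContNear f)
    (cg : ContNear g) : LocSubmean fun ζ => f ζ + g ζ := by
  filter_upwards [hf, hg, cf.circleIntegrable, cg.circleIntegrable] with r h1 h2 h3 h4
  rw [Real.circleAverage_fun_add h3 h4]
  exact add_le_add h1 h2

theorem LocSubmean.const_mul {f : ℂ → ℝ} (hf : LocSubmean f) {c : ℝ} (hc : 0 ≤ c) :
    LocSubmean fun ζ => c * f ζ := by
  filter_upwards [hf] with r h1
  have := Real.circleAverage_fun_smul (a := c) (f := f) (c := 0) (R := r)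
  simp only [smul_eq_mul] at this
  rw [this]
  exact mul_le_mul_of_nonneg_left h1 hc

theorem _root_.AnalyticAt.contNear {E : Type*} [NormedAddCommGroup E] [NormedSpace ℂ E]
    [CompleteSpace E] {f : ℂ → E} (hf : AnalyticAt ℂ f 0) : ContNear f :=
  hf.eventually_analyticAt.mono fun _ h => h.continuousAt

/-- The logarithm of the modulus of a zero-free holomorphic function has the mean value property. -/
theorem locSubmean_log_norm {f : ℂ → ℂ} (hf : AnalyticAt ℂ f 0) (h0 : f 0 ≠ 0) :
    LocSubmean fun ζ => Real.log ‖f ζ‖ := by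
  have h1 := hf.eventually_analyticAt
  have h2 := hf.continuousAt.eventually_ne h0
  filter_upwards [eventually_closedBall_of_eventually_nhds_zero (h1.and h2), self_mem_nhdsWithin]
    with r hr hr0
  refine (InnerProductSpace.HarmonicOnNhd.circleAverage_eq (f := fun ζ => Real.log ‖f ζ‖) ?_).ge
  intro ζ hζ
  rw [abs_of_pos hr0] at hζ
  exact (hr ζ hζ).1.harmonicAt_log_norm (hr ζ hζ).2

theorem contNear_log_norm {f : ℂ → ℂ} (hf : AnalyticAt ℂ f 0) (h0 : f 0 ≠ 0) :
    ContNear fun ζ => Real.log ‖f ζ‖ := by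
  filter_upwards [hf.eventually_analyticAt, hf.continuousAt.eventually_ne h0] with ζ h1 h2
  exact h1.continuousAt.norm.log (norm_ne_zero_iff.2 h2)

/-! ### Strictly plurisubharmonic functions along holomorphic curves. -/

/-- Taylor's formula of order two with Peano remainder. -/
theorem taylor_two_isLittleO {E : Type*} [NormedAddCommGroup E] [NormedSpace ℝ E] {G : E → ℝ}
    {q : E} (hG : ContDiffAt ℝ 2 G q) :
    (fun h => G (q + h) - G q - fderiv ℝ G q h - fderiv ℝ (fderiv ℝ G) q h h / 2)
      =o[𝓝 0] fun h => ‖h‖ ^ 2 := by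
  set L := fderiv ℝ G q
  set B := fderiv ℝ (fderiv ℝ G) q
  have hsymm : ∀ x y, B x y = B y x := fun x y =>
    (hG.isSymmSndFDerivAt (by simp)).eq x y
  have hB : HasFDerivAt (fderiv ℝ G) B q :=
    ((hG.fderiv_right (m := 1) (by norm_num)).differentiableAt (by norm_num)).hasFDerivAt
  have hd : ∀ᶠ h in 𝓝 (0 : E), HasFDerivAt G (fderiv ℝ G (q + h)) (q + h) := by
    have h1 : ∀ᶠ x in 𝓝 q, HasFDerivAt G (fderiv ℝ G x) x := by
      filter_upwards [hG.eventually (by simp)] with x hx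
      exact (hx.differentiableAt (by norm_num)).hasFDerivAt
    have h2 : Tendsto (fun h : E => q + h) (𝓝 0) (𝓝 q) := by
      have : ContinuousAt (fun h : E => q + h) 0 := by fun_prop
      simpa [ContinuousAt] using this
    exact h2.eventually h1
  rw [Asymptotics.isLittleO_iff]
  intro ε hε
  have hB' := (hasFDerivAt_iff_isLittleO_nhds_zero.1 hB).def hε
  obtain ⟨δ, hδ, H⟩ := Metric.eventually_nhds_iff_ball.1 (hd.and hB')
  filter_upwards [Metric.ball_mem_nhds (0 : E) hδ] with h hh
  have hh' : ‖h‖ < δ := by simpa using hh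
  -- The remainder F vanishes at 0, and by the symmetry of B its derivative is DG(q + x) − L − Bx,
  -- which is at most ε‖h‖ in norm on the ball of radius ‖h‖. The mean value inequality then gives
  -- ε‖h‖².
  set F : E → ℝ := fun h => G (q + h) - G q - L h - B h h / 2
  have hF : ∀ x ∈ Metric.closedBall (0 : E) ‖h‖,
      HasFDerivWithinAt F (fderiv ℝ G (q + x) - L - B x) (Metric.closedBall 0 ‖h‖) x := by
    intro x hx
    have hx' : x ∈ Metric.ball (0 : E) δ := by
      simp only [Metric.mem_closedBall, dist_zero_right] at hx
      simpa using hx.trans_lt hh'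
    have d1 : HasFDerivAt (fun h => G (q + h)) (fderiv ℝ G (q + x)) x := by
      have := (H x hx').1.comp x ((hasFDerivAt_id x).const_add q)
      rw [ContinuousLinearMap.comp_id] at this
      exact this
    have d2 : HasFDerivAt (fun h => B h h) (B.precompR E x (.id ℝ E) + B.precompL E (.id ℝ E) x) x :=
      B.hasFDerivAt_of_bilinear (hasFDerivAt_id x) (hasFDerivAt_id x)
    have d3 := ((d1.sub_const (G q)).sub L.hasFDerivAt).sub (d2.mul_const (1 / 2 : ℝ))
    refine ((d3.congr_fderiv ?_).congr_of_eventuallyEq (.of_forall ?_)).hasFDerivWithinAt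
    · ext y
      simp [ContinuousLinearMap.precompR_apply, ContinuousLinearMap.precompL_apply, hsymm y x]
      ring
    · intro y
      simp only [F, Pi.sub_apply]
      ring
  have hbound : ∀ x ∈ Metric.closedBall (0 : E) ‖h‖, ‖fderiv ℝ G (q + x) - L - B x‖ ≤ ε * ‖h‖ := by
    intro x hx
    simp only [Metric.mem_closedBall, dist_zero_right] at hx
    have hx' : x ∈ Metric.ball (0 : E) δ := by simpa using hx.trans_lt hh'
    exact (H x hx').2.trans (by gcongr)
  have := (convex_closedBall (0 : E) ‖h‖).norm_image_sub_le_of_norm_hasFDerivWithin_le hF hbound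
    (Metric.mem_closedBall_self (norm_nonneg h)) (y := h) (by simp)
  simp only [F, map_zero, add_zero, sub_self, sub_zero, zero_div] at this
  rw [norm_pow, norm_norm, pow_two, ← mul_assoc]
  exact this

/-- In the real basis w, iw of the complex line the cross terms carry sin θ cos θ and average to
zero, while cos² and sin² average to 1/2. -/
theorem circleAverage_quadratic {E : Type*} [NormedAddCommGroup E] [NormedSpace ℂ E]
    (B : E →L[ℝ] E →L[ℝ] ℝ) (w : E) (r : ℝ) :
    Real.circleAverage (fun ζ => B (ζ • w) (ζ • w)) 0 r =
      r ^ 2 * ((B w w + B (Complex.I • w) (Complex.I • w)) / 2) := by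
  have key : ∀ θ : ℝ, B (circleMap 0 r θ • w) (circleMap 0 r θ • w) =
      r ^ 2 * (B w w) * Real.cos θ ^ 2 +
      r ^ 2 * (B (Complex.I • w) (Complex.I • w)) * Real.sin θ ^ 2 +
      r ^ 2 * (B w (Complex.I • w) + B (Complex.I • w) w) * (Real.sin θ * Real.cos θ) := by
    intro θ
    have : circleMap 0 r θ • w = (r * Real.cos θ) • w + (r * Real.sin θ) • (Complex.I • w) := by
      rw [circleMap, zero_add, Complex.exp_mul_I, ← Complex.ofReal_cos, ← Complex.ofReal_sin,
        ← Complex.coe_smul, ← Complex.coe_smul, smul_smul, ← add_smul]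
      push_cast
      ring_nf
    rw [this]
    simp only [map_add, map_smul, add_apply, smul_apply, smul_eq_mul]
    ring
  rw [Real.circleAverage_def]
  simp_rw [key]
  rw [intervalIntegral.integral_add, intervalIntegral.integral_add,
    intervalIntegral.integral_const_mul, intervalIntegral.integral_const_mul,
    intervalIntegral.integral_const_mul, integral_cos_sq, integral_sin_sq, integral_sin_mul_cos₁]
  · simp
    field_simp
  all_goals exact Continuous.intervalIntegrable (by fun_prop) _ _

/-- A strictly plurisubharmonic function restricts to a function with the sub-mean value
property on a regular holomorphic curve. -/
theorem locSubmean_comp_of_leviForm_pos {E : Type*} [NormedAddCommGroup E] [NormedSpace ℂ E]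
    [CompleteSpace E]
    {G : E → ℝ} {γ : ℂ → E} (hγ : AnalyticAt ℂ γ 0) (hG : ContDiffAt ℝ 2 G (γ 0))
    (hL : 0 < leviForm G (γ 0) (deriv γ 0)) :
    ContNear (fun ζ => G (γ ζ)) ∧ LocSubmean fun ζ => G (γ ζ) := by
  set q := γ 0 with hq
  set w := deriv γ 0
  set L := fderiv ℝ G q
  set B := fderiv ℝ (fderiv ℝ G) q
  have cG : ContNear fun ζ => G (γ ζ) := by
    have : ∀ᶠ x in 𝓝 (γ 0), ContinuousAt G x :=
      (hG.eventually (by simp)).mono fun _ h => h.continuousAt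
    filter_upwards [hγ.contNear, hγ.continuousAt.eventually this] with ζ h1 h2
    exact ContinuousAt.comp h2 h1
  refine ⟨cG, ?_⟩
  have hh0 : Tendsto (fun ζ => γ ζ - q) (𝓝 0) (𝓝 0) := by
    have : ContinuousAt (fun ζ => γ ζ - q) 0 := hγ.continuousAt.sub continuousAt_const
    simpa [ContinuousAt, hq] using this
  have hd : HasDerivAt γ w 0 := hγ.differentiableAt.hasDerivAt
  have e1 : (fun ζ => γ ζ - q - ζ • w) =o[𝓝 0] fun ζ : ℂ => ζ := by
    have := hasDerivAt_iff_isLittleO.1 hd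
    simpa using this
  have O1 : (fun ζ : ℂ => ζ • w) =O[𝓝 0] fun ζ : ℂ => ζ :=
    .of_bound ‖w‖ (.of_forall fun ζ => by rw [norm_smul, mul_comm])
  have O2 : (fun ζ => γ ζ - q) =O[𝓝 0] fun ζ : ℂ => ζ := by
    have := e1.isBigO.add O1
    simpa using this
  have bil : ∀ {f g : ℂ → E}, (fun ζ => B (f ζ) (g ζ)) =O[𝓝 0] fun ζ => ‖f ζ‖ * ‖g ζ‖ := by
    intro f g
    refine .of_bound ‖B‖ (.of_forall fun ζ => ?_)
    rw [norm_mul, norm_norm, norm_norm, ← mul_assoc]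
    exact B.le_opNorm₂ _ _
  have e2 : (fun ζ => B (γ ζ - q) (γ ζ - q) - B (ζ • w) (ζ • w)) =o[𝓝 0] fun ζ : ℂ => ‖ζ‖ ^ 2 := by
    have a1 : (fun ζ => B (γ ζ - q - ζ • w) (γ ζ - q)) =o[𝓝 0] fun ζ : ℂ => ‖ζ‖ * ‖ζ‖ :=
      bil.trans_isLittleO (e1.norm_norm.mul_isBigO O2.norm_norm)
    have a2 : (fun ζ => B (ζ • w) (γ ζ - q - ζ • w)) =o[𝓝 0] fun ζ : ℂ => ‖ζ‖ * ‖ζ‖ :=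
      bil.trans_isLittleO (O1.norm_norm.mul_isLittleO e1.norm_norm)
    refine (a1.add a2).congr (fun ζ => ?_) (fun ζ => (pow_two _).symm)
    simp only [map_sub, sub_apply]
    ring
  have e3 : (fun ζ => G (γ ζ) - G q - L (γ ζ - q) - B (γ ζ - q) (γ ζ - q) / 2)
      =o[𝓝 0] fun ζ : ℂ => ‖ζ‖ ^ 2 := by
    have := ((taylor_two_isLittleO hG).comp_tendsto hh0).trans_isBigO (O2.norm_norm.pow 2)
    refine this.congr_left fun ζ => ?_
    simp [L, B]
  -- The linear term keeps the whole increment γ ζ − q instead of its expansion: being real linear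
  -- in a holomorphic function it has mean exactly zero, so the second derivative of γ never enters.
  have e4 : (fun ζ => G (γ ζ) - (G q + L (γ ζ - q) + 1 / 2 * B (ζ • w) (ζ • w)))
      =o[𝓝 0] fun ζ : ℂ => ‖ζ‖ ^ 2 := by
    refine (e3.add (e2.const_mul_left (1 / 2))).congr_left fun ζ => ?_
    ring
  have hΛ : leviForm G q w = 1 / 2 * ((B w w + B (Complex.I • w) (Complex.I • w)) / 2) := by
    rw [leviForm]; ring
  have cγ : ContNear fun ζ => L (γ ζ - q) := hγ.contNear.mono fun ζ h => by fun_prop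
  have cq : ContNear fun ζ : ℂ => 1 / 2 * B (ζ • w) (ζ • w) := .of_forall fun ζ => by fun_prop
  have c1 : ContNear fun ζ => L (γ ζ - q) + 1 / 2 * B (ζ • w) (ζ • w) := by
    filter_upwards [cγ, cq] with ζ h1 h2 using h1.add h2
  filter_upwards [cγ.circleIntegrable, cq.circleIntegrable, c1.circleIntegrable, cG.circleIntegrable,
    eventually_closedBall_of_eventually_nhds_zero hγ.eventually_analyticAt,
    eventually_sphere_of_eventually_nhds_zero (e4.def hL), self_mem_nhdsWithin]
    with r i1 i2 i12 i3 han hle hr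
  have hr0 : (0 : ℝ) < r := hr
  have m1 : Real.circleAverage (fun ζ => L (γ ζ - q)) 0 r = 0 := by
    have hdc : DiffContOnCl ℂ (fun ζ => γ ζ - q) (Metric.ball 0 |r|) := by
      rw [abs_of_pos hr0]
      refine DifferentiableOn.diffContOnCl fun ζ hζ => ?_
      rw [closure_ball _ hr0.ne'] at hζ
      exact ((han ζ hζ).differentiableAt.sub_const q).differentiableWithinAt
    have hci : CircleIntegrable (fun ζ => γ ζ - q) 0 r := by
      refine ContinuousOn.circleIntegrable hr0.le fun ζ hζ => ?_
      exact ((han ζ (Metric.sphere_subset_closedBall hζ)).continuousAt.sub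
        continuousAt_const).continuousWithinAt
    have := L.circleAverage_comp_comm hci
    rw [hdc.circleAverage, ← hq, sub_self, map_zero] at this
    exact this
  have m2 := circleAverage_quadratic B w r
  have m3 : Real.circleAverage (fun ζ => 1 / 2 * B (ζ • w) (ζ • w)) 0 r =
      r ^ 2 * leviForm G q w := by
    have := Real.circleAverage_fun_smul (a := (1 / 2 : ℝ)) (f := fun ζ => B (ζ • w) (ζ • w))
      (c := 0) (R := r)
    simp only [smul_eq_mul] at this
    rw [this, m2, hΛ]
    ring
  -- The o(r²) error is used with the Levi form itself as constant, so that its worst case exactly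
  -- cancels the mean of the quadratic term.
  have m4 : Real.circleAverage (fun ζ => (G q - leviForm G q w * r ^ 2) +
      (L (γ ζ - q) + 1 / 2 * B (ζ • w) (ζ • w))) 0 r = G q := by
    rw [Real.circleAverage_fun_add (circleIntegrable_const _ _ _) i12,
      Real.circleAverage_fun_add i1 i2, m1, m3, Real.circleAverage_const]
    ring
  rw [← hq, ← m4]
  refine Real.circleAverage_mono ((circleIntegrable_const _ _ _).add i12) i3 fun ζ hζ => ?_
  have h1 := hle ζ hζ
  rw [mem_sphere_zero_iff_norm, abs_of_pos hr0] at hζ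
  rw [hζ, norm_pow, Real.norm_of_nonneg hr0.le, Real.norm_eq_abs] at h1
  have := (abs_le.1 h1).1
  linarith

/-! ### Comparison of extended-valued and real circle means. -/

theorem circleMean_mono {f g : ℝ → EReal} (h : ∀ θ, f θ ≤ g θ) : circleMean f ≤ circleMean g := by
  unfold circleMean
  simp only [laverage_eq']
  refine EReal.sub_le_sub ?_ ?_
  · exact EReal.coe_ennreal_le_coe_ennreal_iff.2
      (lintegral_mono fun θ => EReal.toENNReal_le_toENNReal (h θ))
  · exact EReal.coe_ennreal_le_coe_ennreal_iff.2
      (lintegral_mono fun θ => EReal.toENNReal_le_toENNReal (EReal.neg_le_neg_iff.2 (h θ)))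

theorem circleMean_coe {f : ℂ → ℝ} {r : ℝ} (hf : CircleIntegrable f 0 r) :
    circleMean (fun θ => (f (circleMap 0 r θ) : EReal)) = (Real.circleAverage f 0 r : ℝ) := by
  have hpi : (0 : ℝ) ≤ 2 * Real.pi := by positivity
  rw [Real.circleAverage_eq_intervalAverage, uIoc_of_le hpi, average]
  unfold circleMean
  simp only [laverage_eq']
  have hi : Integrable (fun θ => f (circleMap 0 r θ))
      (((volume.restrict (Ioc 0 (2 * Real.pi))) univ)⁻¹ • volume.restrict (Ioc 0 (2 * Real.pi))) := by
    refine Integrable.smul_measure ?_ ?_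
    · exact (intervalIntegrable_iff_integrableOn_Ioc_of_le hpi).1 hf
    · simp [Real.pi_pos]
  rw [integral_eq_lintegral_pos_part_sub_lintegral_neg_part hi]
  have hneg : ∀ θ, (-(f (circleMap 0 r θ) : EReal)).toENNReal
      = ENNReal.ofReal (-f (circleMap 0 r θ)) := fun θ => by
    rw [← EReal.coe_neg, EReal.toENNReal_of_ne_top (EReal.coe_ne_top _), EReal.toReal_coe]
  have hpos : ∀ θ, ((f (circleMap 0 r θ) : EReal)).toENNReal
      = ENNReal.ofReal (f (circleMap 0 r θ)) := fun θ => by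
    rw [EReal.toENNReal_of_ne_top (EReal.coe_ne_top _), EReal.toReal_coe]
  simp only [hneg, hpos]
  rw [EReal.coe_sub, EReal.coe_ennreal_toReal, EReal.coe_ennreal_toReal]
  · exact hi.neg.lintegral_lt_top.ne
  · exact hi.lintegral_lt_top.ne

/-! ### Levi form: quadratic perturbations and local lower bounds. -/

section Levi

variable {E : Type*} [NormedAddCommGroup E] [InnerProductSpace ℂ E]

theorem leviForm_add_norm_sq {G : E → ℝ} {x : E} (hG : ContDiffAt ℝ 2 G x) (a : E) (b c : ℝ)
    (v : E) :
    leviForm (fun y => G y + c * ‖y - a‖ ^ 2 + b) x v = leviForm G x v + c * ‖v‖ ^ 2 := by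
  let _ : InnerProductSpace ℝ E := InnerProductSpace.complexToReal
  have hN : ∀ y : E, HasFDerivAt (fun y : E => ‖y - a‖ ^ 2) (2 • innerSL ℝ (y - a)) y := fun y => by
    have := ((hasFDerivAt_id (𝕜 := ℝ) y).sub_const a).norm_sq
    simpa using this
  have h1 : fderiv ℝ (fun y => G y + c * ‖y - a‖ ^ 2 + b) =ᶠ[𝓝 x]
      fun y => fderiv ℝ G y + c • (2 • innerSL ℝ (y - a)) := by
    filter_upwards [hG.eventually (by simp)] with y hy
    exact (((hy.differentiableAt (by norm_num)).hasFDerivAt.add ((hN y).const_mul c)).add_const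
      b).fderiv
  have hB : HasFDerivAt (fderiv ℝ G) (fderiv ℝ (fderiv ℝ G) x) x :=
    ((hG.fderiv_right (m := 1) (by norm_num)).differentiableAt (by norm_num)).hasFDerivAt
  have hS : HasFDerivAt (fun y : E => innerSL ℝ (y - a)) (innerSL ℝ : E →L[ℝ] E →L[ℝ] ℝ) x := by
    have := (innerSL ℝ : E →L[ℝ] E →L[ℝ] ℝ).hasFDerivAt.comp x ((hasFDerivAt_id x).sub_const a)
    rw [ContinuousLinearMap.comp_id] at this
    exact this
  have h2 := (hB.add ((hS.const_smul 2).const_smul c)).fderiv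
  rw [leviForm, leviForm, h1.fderiv_eq]
  have h3 : (fun y => fderiv ℝ G y + c • (2 • innerSL ℝ (y - a))) =
    (fderiv ℝ G + c • 2 • fun y => innerSL ℝ (y - a)) := rfl
  rw [h3, h2]
  have hI : ‖Complex.I • v‖ = ‖v‖ := by rw [norm_smul, Complex.norm_I, one_mul]
  have hin : ∀ y : E, innerSL ℝ y y = ‖y‖ ^ 2 := fun y => real_inner_self_eq_norm_sq y
  simp only [add_apply, smul_apply, hin, hI, smul_eq_mul, nsmul_eq_mul]
  push_cast
  ring

theorem contDiffAt_add_norm_sq {G : E → ℝ} {x : E} (hG : ContDiffAt ℝ 2 G x) (a : E) (b c : ℝ) :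
    ContDiffAt ℝ 2 (fun y => G y + c * ‖y - a‖ ^ 2 + b) x := by
  let _ : InnerProductSpace ℝ E := InnerProductSpace.complexToReal
  exact (hG.add (contDiffAt_const.mul ((contDiffAt_id.sub contDiffAt_const).norm_sq ℝ))).add
    contDiffAt_const

theorem leviForm_smul (G : E → ℝ) (x v : E) (t : ℝ) :
    leviForm G x (t • v) = t ^ 2 * leviForm G x v := by
  simp only [leviForm, smul_comm Complex.I t v, map_smul, smul_apply, smul_eq_mul]
  ring

/-- By compactness of the unit sphere the Levi form has a positive minimum there at q, half of which
persists nearby by continuity. Homogeneity of degree two does the rest. -/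
theorem IsStrictPSHOn.exists_leviForm_lower_bound [FiniteDimensional ℂ E] {G : E → ℝ} {Ω : Set E}
    (hG : IsStrictPSHOn G Ω) (hΩ : IsOpen Ω) {q : E} (hq : q ∈ Ω) :
    ∃ c > 0, ∀ᶠ x in 𝓝 q, ∀ v ≠ 0, c * ‖v‖ ^ 2 < leviForm G x v := by
  have : ProperSpace E := FiniteDimensional.proper ℂ E
  have hC : ContinuousAt (fderiv ℝ (fderiv ℝ G)) q :=
    (((hG.1.contDiffAt (hΩ.mem_nhds hq)).fderiv_right (m := 1) (by norm_num)).fderiv_right (m := 0)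
      (by norm_num)).continuousAt
  have hcont : ∀ v : E, ContinuousAt (fun z : E × E => leviForm G z.1 z.2) (q, v) := by
    intro v
    have h1 : ContinuousAt (fun z : E × E => fderiv ℝ (fderiv ℝ G) z.1) (q, v) :=
      ContinuousAt.comp (f := Prod.fst) (x := (q, v)) hC continuousAt_fst
    unfold leviForm
    have h2 : ContinuousAt (fun z : E × E => Complex.I • z.2) (q, v) :=
      continuousAt_snd.const_smul _
    exact (((h1.clm_apply continuousAt_snd).clm_apply continuousAt_snd).add
      ((h1.clm_apply h2).clm_apply h2)).div_const 4
  have hS : IsCompact (Metric.sphere (0 : E) 1) := isCompact_sphere _ _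
  have hne : ∀ v ∈ Metric.sphere (0 : E) 1, v ≠ 0 := by
    rintro v hv rfl
    simp at hv
  obtain ⟨m, hm, hmin⟩ := hS.exists_forall_le' (f := fun v => leviForm G q v) (a := 0)
    (fun v _ => ((hcont v).comp (f := fun v => (q, v)) (by fun_prop)).continuousWithinAt)
    (fun v hv => hG.2 q hq v (hne v hv))
  refine ⟨m / 2, by positivity, ?_⟩
  have := hS.eventually_forall_of_forall_eventually (x₀ := q)
    (P := fun x v => m / 2 < leviForm G x v) fun v hv => by
      have h := hmin v hv
      exact (hcont v).eventually (lt_mem_nhds (show m / 2 < leviForm G q v by linarith))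
  filter_upwards [this] with x hx v hv
  have hv' : 0 < ‖v‖ := norm_pos_iff.2 hv
  have h1 := hx (‖v‖⁻¹ • v) (by simp [norm_smul, hv])
  rw [leviForm_smul] at h1
  have h2 := mul_lt_mul_of_pos_left h1 (pow_pos hv' 2)
  rw [← mul_assoc, ← mul_pow, mul_inv_cancel₀ hv'.ne', one_pow, one_mul] at h2
  linarith

end Levi

/-! ### Sub-mean value property along holomorphic curves. -/

section HolSubmean

variable {E : Type*} [NormedAddCommGroup E] [NormedSpace ℂ E]

/-- The local sub-mean value property along all regular holomorphic curves through a point. -/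
def HolSubmeanAt (m : E → ℝ) (q : E) : Prop :=
  ∀ γ : ℂ → E, AnalyticAt ℂ γ 0 → γ 0 = q → deriv γ 0 ≠ 0 →
    ContNear (fun ζ => m (γ ζ)) ∧ LocSubmean fun ζ => m (γ ζ)

theorem holSubmeanAt_of_leviForm_pos [CompleteSpace E] {m : E → ℝ} {q : E}
    (hm : ContDiffAt ℝ 2 m q) (hL : ∀ v ≠ 0, 0 < leviForm m q v) : HolSubmeanAt m q := by
  rintro γ hγ rfl hd
  exact locSubmean_comp_of_leviForm_pos hγ hm (hL _ hd)

theorem holSubmeanAt_log_norm {l : E → ℂ} {q : E} (hl : AnalyticAt ℂ l q) (h0 : l q ≠ 0) :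
    HolSubmeanAt (fun x => Real.log ‖l x‖) q := by
  rintro γ hγ rfl -
  exact ⟨contNear_log_norm (hl.comp hγ) h0, locSubmean_log_norm (hl.comp hγ) h0⟩

theorem HolSubmeanAt.add {f g : E → ℝ} {q : E} (hf : HolSubmeanAt f q) (hg : HolSubmeanAt g q) :
    HolSubmeanAt (fun x => f x + g x) q := by
  intro γ hγ h0 hd
  have h1 := hf γ hγ h0 hd
  have h2 := hg γ hγ h0 hd
  exact ⟨(h1.1.and h2.1).mono fun _ h => h.1.add h.2, h1.2.add h2.2 h1.1 h2.1⟩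

theorem HolSubmeanAt.const_mul {f : E → ℝ} {q : E} (hf : HolSubmeanAt f q) {c : ℝ} (hc : 0 ≤ c) :
    HolSubmeanAt (fun x => c * f x) q := by
  intro γ hγ h0 hd
  have h1 := hf γ hγ h0 hd
  exact ⟨h1.1.mono fun _ h => continuousAt_const.mul h, h1.2.const_mul hc⟩

theorem tendsto_line (p v : E) :
    Tendsto (fun ζ : ℂ => p + ζ • v) (𝓝 0) (𝓝 p) := by
  have : ContinuousAt (fun ζ : ℂ => p + ζ • v) 0 := by fun_prop
  simpa [ContinuousAt] using this

theorem contNear_line {M X : Type*} [TopologicalSpace M] [TopologicalSpace X]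
    (e : OpenPartialHomeomorph M E) {p : E} (hp : p ∈ e.target) (v : E) {w : M → X}
    (hw : Continuous w) : ContNear fun ζ : ℂ => w (e.symm (p + ζ • v)) := by
  filter_upwards [(tendsto_line p v).eventually (e.open_target.mem_nhds hp)] with ζ hζ
  refine hw.continuousAt.comp (ContinuousAt.comp (f := fun ζ : ℂ => p + ζ • v)
    (e.symm.continuousAt ?_) (by fun_prop))
  exact hζ

end HolSubmean

/-! ### Real-valued continuous plurisubharmonic functions on the manifold. -/

section Manifold

variable {n : ℕ} {M : Type*} [TopologicalSpace M] [ChartedSpace (EuclideanSpace ℂ (Fin n)) M]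

variable (n) in
/-- Real valued continuous plurisubharmonic functions, with the mean values taken in `ℝ`. -/
structure IsContPSH (w : M → ℝ) : Prop where
  cont : Continuous w
  submean : ∀ e ∈ atlas (EuclideanSpace ℂ (Fin n)) M, ∀ p ∈ e.target, ∀ v,
    LocSubmean fun ζ : ℂ => w (e.symm (p + ζ • v))

theorem IsContPSH.mem_PSHcb {w : M → ℝ} (hw : IsContPSH n w) {C : ℝ} (hC : ∀ z, w z ≤ C) :
    (fun z => (w z : EReal)) ∈ PSHcb n (M := M) := by
  have hc : Continuous fun z => (w z : EReal) := continuous_coe_real_ereal.comp hw.cont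
  have hP : (fun z => (w z : EReal)) ∈ PSH n (M := M) := by
    intro e he
    refine ⟨?_, fun p _ => EReal.coe_ne_top _, fun p hp v => ?_⟩
    · exact (hc.comp_continuousOn e.continuousOn_symm).upperSemicontinuousOn
    · filter_upwards [hw.submean e he p hp v, (contNear_line e hp v hw.cont).circleIntegrable]
        with r h1 h2
      have := circleMean_coe h2
      simp only [Function.comp_apply]
      rw [this, EReal.coe_le_coe_iff]
      simpa using h1
  exact ⟨⟨hP, C, fun z => EReal.coe_le_coe_iff.2 (hC z)⟩, hP, hc⟩

/-- Truncation from below removes the value −∞, so that all later work uses ordinary integrals. The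
inequality survives because the mean dominates both u and a. -/
theorem isContPSH_toReal_max {u : M → EReal} (hu : u ∈ PSHcb n (M := M)) (a : ℝ) :
    IsContPSH n fun z => (max (u z) a).toReal := by
  obtain ⟨⟨hP, C, hC⟩, -, hc⟩ := hu
  have htop : ∀ z, max (u z) a ≠ ⊤ := fun z => by
    refine ((max_lt_iff.2 ⟨(hC z).trans_lt (EReal.coe_lt_top _), EReal.coe_lt_top _⟩)).ne
  have hbot : ∀ z, max (u z) a ≠ ⊥ := fun z =>
    ((EReal.bot_lt_coe a).trans_le (le_max_right _ _)).ne'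
  have hco : ∀ z, (((max (u z) a).toReal : ℝ) : EReal) = max (u z) a := fun z =>
    EReal.coe_toReal (htop z) (hbot z)
  have hcont : Continuous fun z => (max (u z) a).toReal :=
    EReal.continuousOn_toReal.comp_continuous (hc.max continuous_const)
      fun z => by simp [htop z, hbot z]
  refine ⟨hcont, fun e he p hp v => ?_⟩
  filter_upwards [(hP e he).submean p hp v, (contNear_line e hp v hcont).circleIntegrable]
    with r h1 h2
  have h3 := circleMean_coe h2
  have h4 : a ≤ Real.circleAverage (fun ζ : ℂ => (max (u (e.symm (p + ζ • v))) a).toReal) 0 r := by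
    have := Real.circleAverage_mono (circleIntegrable_const a 0 r) h2 fun ζ _ => by
      rw [← EReal.coe_le_coe_iff, hco]
      exact le_max_right _ _
    rwa [Real.circleAverage_const] at this
  rw [← EReal.coe_le_coe_iff, hco, zero_smul, add_zero]
  refine max_le ?_ (EReal.coe_le_coe_iff.2 h4)
  rw [← h3]
  refine h1.trans (circleMean_mono fun θ => ?_)
  rw [hco]
  exact le_max_left _ _

theorem isContPSH_const (a : ℝ) : IsContPSH n fun _ : M => a :=
  ⟨continuous_const, fun _ _ _ _ _ => locSubmean_const a⟩

theorem IsContPSH.sup {f g : M → ℝ} (hf : IsContPSH n f) (hg : IsContPSH n g) :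
    IsContPSH n fun z => max (f z) (g z) := by
  refine ⟨hf.cont.max hg.cont, fun e he p hp v => ?_⟩
  have hc := contNear_line e hp v (hf.cont.max hg.cont)
  rcases le_total (f (e.symm (p + (0 : ℂ) • v))) (g (e.symm (p + (0 : ℂ) • v))) with h | h
  · exact (hg.submean e he p hp v).of_minorant (contNear_line e hp v hg.cont) hc
      (.of_forall fun ζ => le_max_right _ _) (max_eq_right h)
  · exact (hf.submean e he p hp v).of_minorant (contNear_line e hp v hf.cont) hc
      (.of_forall fun ζ => le_max_left _ _) (max_eq_left h)

theorem IsContPSH.affine {f : M → ℝ} (hf : IsContPSH n f) {c : ℝ} (hc : 0 ≤ c) (b : ℝ) :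
    IsContPSH n fun z => c * f z + b := by
  refine ⟨(continuous_const.mul hf.cont).add continuous_const, fun e he p hp v => ?_⟩
  have h := contNear_line e hp v hf.cont
  exact ((hf.submean e he p hp v).const_mul hc).add (locSubmean_const b)
    (h.mono fun _ h => continuousAt_const.mul h) (.of_forall fun _ => continuousAt_const)

variable [IsManifold 𝓘(ℂ, EuclideanSpace ℂ (Fin n)) ω M]

theorem analyticAt_transition {e e' : OpenPartialHomeomorph M (EuclideanSpace ℂ (Fin n))}
    (he : e ∈ atlas (EuclideanSpace ℂ (Fin n)) M) (he' : e' ∈ atlas (EuclideanSpace ℂ (Fin n)) M)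
    {p : EuclideanSpace ℂ (Fin n)} (hp : p ∈ e.target) (hp' : e.symm p ∈ e'.source) :
    AnalyticAt ℂ (fun x => e' (e.symm x)) p := by
  have h := HasGroupoid.compatible (G := contDiffGroupoid ω 𝓘(ℂ, EuclideanSpace ℂ (Fin n))) he he'
  rw [contDiffGroupoid, mem_groupoid_of_pregroupoid] at h
  have h1 := h.1
  simp only [contDiffPregroupoid, modelWithCornersSelf_coe,
    modelWithCornersSelf_coe_symm, Function.comp_id, Function.id_comp, preimage_id, range_id,
    inter_univ] at h1
  have h2 : ContDiffAt ℂ ω (fun x => e' (e.symm x)) p :=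
    h1.contDiffAt ((e.symm.trans e').open_source.mem_nhds (by simp [hp, hp']))
  exact h2.analyticAt

/-- A complex line of one chart is only a holomorphic curve in another. It stays regular because the
transition has a holomorphic inverse: by the chain rule a zero derivative would force v = 0. -/
theorem deriv_transition_line_ne_zero {e e' : OpenPartialHomeomorph M (EuclideanSpace ℂ (Fin n))}
    (he : e ∈ atlas (EuclideanSpace ℂ (Fin n)) M) (he' : e' ∈ atlas (EuclideanSpace ℂ (Fin n)) M)
    {p : EuclideanSpace ℂ (Fin n)} (hp : p ∈ e.target) (hp' : e.symm p ∈ e'.source)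
    {v : EuclideanSpace ℂ (Fin n)} (hv : v ≠ 0) :
    AnalyticAt ℂ (fun ζ : ℂ => e' (e.symm (p + ζ • v))) 0 ∧
      deriv (fun ζ : ℂ => e' (e.symm (p + ζ • v))) 0 ≠ 0 := by
  have hline : AnalyticAt ℂ (fun ζ : ℂ => p + ζ • v) 0 := by fun_prop
  have hγ : AnalyticAt ℂ (fun ζ : ℂ => e' (e.symm (p + ζ • v))) 0 := by
    refine AnalyticAt.comp_of_eq (g := fun x => e' (e.symm x))
      (analyticAt_transition he he' hp hp') hline ?_
    simp
  refine ⟨hγ, fun h0 => hv ?_⟩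
  have hback : AnalyticAt ℂ (fun x => e (e'.symm x)) (e' (e.symm p)) :=
    analyticAt_transition he' he (e'.map_source hp') (by rw [e'.left_inv hp']; exact e.map_target hp)
  have hd := hγ.differentiableAt.hasDerivAt
  rw [h0] at hd
  have hcomp : HasDerivAt (fun ζ : ℂ => e (e'.symm (e' (e.symm (p + ζ • v))))) 0 0 := by
    have := HasFDerivAt.comp_hasDerivAt_of_eq (0 : ℂ) hback.differentiableAt.hasFDerivAt hd
      (by simp)
    rwa [map_zero] at this
  have hev : (fun ζ : ℂ => p + ζ • v) =ᶠ[𝓝 0]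
      fun ζ : ℂ => e (e'.symm (e' (e.symm (p + ζ • v)))) := by
    have hs : ∀ᶠ x in 𝓝 p, e.symm x ∈ e'.source :=
      (e.symm.continuousAt (x := p) hp).eventually (e'.open_source.mem_nhds hp')
    filter_upwards [(tendsto_line p v).eventually (hs.and (e.open_target.mem_nhds hp))] with ζ hζ
    rw [e'.left_inv hζ.1, e.right_inv hζ.2]
  have hl : HasDerivAt (fun ζ : ℂ => p + ζ • v) v 0 := by
    simpa using ((hasDerivAt_id (0 : ℂ)).smul_const v).const_add p
  exact hl.unique (hcomp.congr_of_eventuallyEq hev)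

/-- A continuous function is plurisubharmonic if at every point it is touched from below by a
function with the sub-mean value property. -/
theorem isContPSH_of_touching {F : M → ℝ} (hF : Continuous F)
    (h : ∀ z, (∃ u, IsContPSH n u ∧ (∀ᶠ y in 𝓝 z, u y ≤ F y) ∧ F z = u z) ∨
      ∃ e' ∈ atlas (EuclideanSpace ℂ (Fin n)) M, z ∈ e'.source ∧ ∃ m, HolSubmeanAt m (e' z) ∧
        (∀ᶠ x in 𝓝 (e' z), m x ≤ F (e'.symm x)) ∧ F z = m (e' z)) : IsContPSH n F := by
  refine ⟨hF, fun e he p hp v => ?_⟩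
  have hc := contNear_line e hp v hF
  have ht : Tendsto (fun ζ : ℂ => e.symm (p + ζ • v)) (𝓝 0) (𝓝 (e.symm p)) :=
    (e.symm.continuousAt (x := p) hp).tendsto.comp (tendsto_line p v)
  rcases h (e.symm p) with ⟨u, hu, hle, heq⟩ | ⟨e', he', hs, m, hm, hle, heq⟩
  · exact (hu.submean e he p hp v).of_minorant (contNear_line e hp v hu.cont) hc
      (ht.eventually hle) (by simpa using heq)
  · by_cases hv : v = 0
    · simp only [hv, smul_zero, add_zero]
      exact locSubmean_const _
    · obtain ⟨hγ, hd⟩ := deriv_transition_line_ne_zero he he' hp hs hv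
      obtain ⟨c1, s1⟩ := hm _ hγ (by simp) hd
      refine s1.of_minorant c1 hc ?_ (by simpa using heq)
      have ht' : Tendsto (fun ζ : ℂ => e' (e.symm (p + ζ • v))) (𝓝 0) (𝓝 (e' (e.symm p))) :=
        (e'.continuousAt hs).tendsto.comp ht
      filter_upwards [ht'.eventually hle, ht.eventually (e'.open_source.mem_nhds hs)] with ζ h1 h2
      rwa [e'.left_inv h2] at h1

end Manifold

/-! ### The radial function that lowers a value at one point. -/

section Dip

/-- A nonpositive radial function of `y = ‖x‖² + ε`, which vanishes for `y ≥ Y` and equals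
`Y log y - y` up to a constant for `y ≤ Y`. -/
noncomputable def dip (Y y : ℝ) : ℝ := Y * Real.log (min y Y / Y) + Y - min y Y

theorem dip_nonpos {Y y : ℝ} (hY : 0 < Y) (hy : 0 < y) : dip Y y ≤ 0 := by
  have h := Real.log_le_sub_one_of_pos (div_pos (lt_min hy hY) hY)
  have h2 := mul_le_mul_of_nonneg_left h hY.le
  rw [mul_sub, mul_div_cancel₀ _ hY.ne', mul_one] at h2
  unfold dip
  linarith

theorem dip_of_le {Y y : ℝ} (hY : 0 < Y) (h : Y ≤ y) : dip Y y = 0 := by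
  rw [dip, min_eq_right h, div_self hY.ne', Real.log_one]
  ring

theorem dip_of_ge {Y y : ℝ} (hY : 0 < Y) (hy : 0 < y) (h : y ≤ Y) :
    dip Y y = Y * (Real.log y - Real.log Y) + Y - y := by
  rw [dip, min_eq_left h, Real.log_div hy.ne' hY.ne']

/-- The formula valid for y ≤ Y is a minorant beyond Y too, since log t ≤ t − 1. Thus one expression
serves for touching from below on both sides of Y. -/
theorem le_dip {Y y : ℝ} (hY : 0 < Y) (hy : 0 < y) :
    Y * (Real.log y - Real.log Y) + Y - y ≤ dip Y y := by
  rcases le_total y Y with h | h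
  · exact (dip_of_ge hY hy h).ge
  · rw [dip_of_le hY h, ← Real.log_div hy.ne' hY.ne']
    have h1 := Real.log_le_sub_one_of_pos (div_pos hy hY)
    have h2 := mul_le_mul_of_nonneg_left h1 hY.le
    rw [mul_sub, mul_div_cancel₀ _ hY.ne', mul_one] at h2
    linarith

theorem continuousOn_dip {Y : ℝ} (hY : 0 < Y) : ContinuousOn (dip Y) (Ioi 0) := by
  unfold dip
  refine (((ContinuousOn.log (by fun_prop) fun y hy => ?_).const_mul Y).add
    continuousOn_const).sub (by fun_prop)
  exact (div_pos (lt_min hy hY) hY).ne'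

theorem exists_dip_small {s c L : ℝ} (hs : 0 < s) (hc : 0 < c) (hL : 0 ≤ L) :
    ∃ ε > 0, c * dip (s ^ 2 + ε) ε ≤ -L := by
  have hs2 : 0 < s ^ 2 := by positivity
  have hK : 0 ≤ 1 + L / (c * s ^ 2) := by positivity
  -- With K the exponent, dip(ε) = Y log(ε/Y) + s² ≤ −s²K + s². The 1 in K absorbs s² and the other
  -- summand yields −L/c.
  refine ⟨s ^ 2 * Real.exp (-(1 + L / (c * s ^ 2))), by positivity, ?_⟩
  set K := 1 + L / (c * s ^ 2) with hKdef
  set ε := s ^ 2 * Real.exp (-K) with hε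
  have hε0 : 0 < ε := by positivity
  rw [dip_of_ge (by positivity) hε0 (by linarith)]
  have h1 : Real.log ε = Real.log (s ^ 2) - K := by
    rw [hε, Real.log_mul hs2.ne' (Real.exp_pos _).ne', Real.log_exp]
    ring
  have h2 : Real.log (s ^ 2) ≤ Real.log (s ^ 2 + ε) := Real.log_le_log hs2 (by linarith)
  have h3 : (s ^ 2 + ε) * (Real.log ε - Real.log (s ^ 2 + ε)) ≤ -(s ^ 2 * K) := by
    have a1 : Real.log ε - Real.log (s ^ 2 + ε) ≤ -K := by linarith
    have a2 : (s ^ 2 + ε) * (Real.log ε - Real.log (s ^ 2 + ε)) ≤ (s ^ 2 + ε) * (-K) :=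
      mul_le_mul_of_nonneg_left a1 (by positivity)
    nlinarith
  have h4 : c * (s ^ 2 * K) = c * s ^ 2 + L := by
    rw [hKdef]
    field_simp
  nlinarith [mul_le_mul_of_nonneg_left h3 hc.le]

/-- Cauchy–Schwarz for the vectors (a, √ε) and (b, √ε), with equality at b = a. For fixed a it
bounds log(‖b‖² + ε) from below by a pluriharmonic function of b wherever the logarithm on the left
is defined. -/
theorem log_norm_inner_add_le {E : Type*} [NormedAddCommGroup E] [InnerProductSpace ℂ E] {ε : ℝ}
    (hε : 0 < ε) (a b : E) (h : inner ℂ a b + (ε : ℂ) ≠ 0) :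
    2 * Real.log ‖inner ℂ a b + (ε : ℂ)‖ ≤
      Real.log (‖a‖ ^ 2 + ε) + Real.log (‖b‖ ^ 2 + ε) := by
  rw [← Real.log_mul (by positivity) (by positivity)]
  have h1 : ‖inner ℂ a b + (ε : ℂ)‖ ≤ ‖a‖ * ‖b‖ + ε := by
    refine (norm_add_le _ _).trans (add_le_add (norm_inner_le_norm a b) ?_)
    rw [Complex.norm_real, Real.norm_of_nonneg hε.le]
  have h2 := pow_le_pow_left₀ (norm_nonneg _) h1 2
  have h3 : 2 * Real.log ‖inner ℂ a b + (ε : ℂ)‖ = Real.log (‖inner ℂ a b + (ε : ℂ)‖ ^ 2) := by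
    rw [Real.log_pow]
    norm_num
  rw [h3]
  refine Real.log_le_log (pow_pos (norm_pos_iff.2 h) 2) (h2.trans ?_)
  nlinarith [mul_nonneg hε.le (sq_nonneg (‖a‖ - ‖b‖))]

end Dip

/-! ### Gluing inside a chart ball. -/

section Glue

/-- The part of the domain of the chart `e` which it maps into the ball of radius `R` around `q`. -/
def chartBall {M E : Type*} [TopologicalSpace M] [NormedAddCommGroup E]
    (e : OpenPartialHomeomorph M E) (q : E) (R : ℝ) : Set M :=
  e.source ∩ e ⁻¹' Metric.ball q R

theorem isOpen_chartBall {M E : Type*} [TopologicalSpace M] [NormedAddCommGroup E]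
    (e : OpenPartialHomeomorph M E) (q : E) (R : ℝ) : IsOpen (chartBall e q R) :=
  e.isOpen_inter_preimage Metric.isOpen_ball

/-- In a Hausdorff space the image of the compact ball of radius r is closed, so every point outside
the chart ball has a neighbourhood on which the extension by zero vanishes. -/
theorem continuous_indicator_chartBall {M E : Type*} [TopologicalSpace M] [T2Space M]
    [NormedAddCommGroup E] [ProperSpace E] {e : OpenPartialHomeomorph M E} {q : E} {r R : ℝ}
    (hR : Metric.closedBall q R ⊆ e.target) (hr : r < R) {φ : M → ℝ}
    (hφ : ContinuousOn φ (chartBall e q R))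
    (h0 : ∀ z ∈ chartBall e q R, r < dist (e z) q → φ z = 0) :
    Continuous ((chartBall e q R).indicator φ) := by
  rw [continuous_iff_continuousAt]
  intro z
  by_cases hz : z ∈ chartBall e q R
  · have hn := (isOpen_chartBall e q R).mem_nhds hz
    refine (hφ.continuousAt hn).congr ?_
    filter_upwards [hn] with y hy
    rw [indicator_of_mem hy]
  · have hsub : Metric.closedBall q r ⊆ e.target :=
      (Metric.closedBall_subset_closedBall hr.le).trans hR
    have hK : IsClosed (e.symm '' Metric.closedBall q r) :=
      ((isCompact_closedBall q r).image_of_continuousOn (e.continuousOn_symm.mono hsub)).isClosed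
    have hzK : z ∉ e.symm '' Metric.closedBall q r := by
      rintro ⟨x, hx, rfl⟩
      refine hz ⟨e.map_target (hsub hx), ?_⟩
      rw [mem_preimage, e.right_inv (hsub hx)]
      exact Metric.closedBall_subset_ball hr hx
    have hev : (chartBall e q R).indicator φ =ᶠ[𝓝 z] fun _ => 0 := by
      filter_upwards [hK.isOpen_compl.mem_nhds hzK] with y hy
      by_cases hyN : y ∈ chartBall e q R
      · rw [indicator_of_mem hyN]
        refine h0 y hyN (lt_of_not_ge fun hle => hy ⟨e y, hle, e.left_inv hyN.1⟩)
      · rw [indicator_of_notMem hyN]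
    exact continuousAt_const.congr hev.symm

variable {n : ℕ} {M : Type*} [TopologicalSpace M] [T2Space M]
  [ChartedSpace (EuclideanSpace ℂ (Fin n)) M] [IsManifold 𝓘(ℂ, EuclideanSpace ℂ (Fin n)) ω M]

theorem IsContPSH.exists_glue_max {e : OpenPartialHomeomorph M (EuclideanSpace ℂ (Fin n))}
    (he : e ∈ atlas (EuclideanSpace ℂ (Fin n)) M) {q : EuclideanSpace ℂ (Fin n)} {r R : ℝ}
    (hR : Metric.closedBall q R ⊆ e.target) (hr : r < R) {u : M → ℝ} (hu : IsContPSH n u)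
    {g : EuclideanSpace ℂ (Fin n) → ℝ} (hg : ∀ x ∈ Metric.ball q R, ContDiffAt ℝ 2 g x)
    (hL : ∀ x ∈ Metric.ball q R, ∀ v ≠ 0, 0 < leviForm g x v)
    (hgu : ∀ x ∈ Metric.ball q R, r < dist x q → g x ≤ u (e.symm x)) :
    ∃ w, IsContPSH n w ∧ (∀ z ∈ chartBall e q R, w z = max (u z) (g (e z))) ∧
      ∀ z ∉ chartBall e q R, w z = u z := by
  set w : M → ℝ := fun z => u z + (chartBall e q R).indicator (fun z => max 0 (g (e z) - u z)) z
    with hw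
  have hin : ∀ z ∈ chartBall e q R, w z = max (u z) (g (e z)) := fun z hz => by
    simp only [hw, indicator_of_mem hz]
    rw [← max_add_add_left, add_zero, add_sub_cancel]
  have hout : ∀ z ∉ chartBall e q R, w z = u z := fun z hz => by
    simp only [hw, indicator_of_notMem hz, add_zero]
  have hge : ∀ z, u z ≤ w z := fun z => by
    by_cases hz : z ∈ chartBall e q R
    · rw [hin z hz]; exact le_max_left _ _
    · rw [hout z hz]
  have hcont : Continuous w := by
    refine hu.cont.add (continuous_indicator_chartBall hR hr ?_ ?_)
    · refine continuousOn_const.sup (ContinuousOn.sub ?_ hu.cont.continuousOn)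
      have h1 : ContinuousOn g (Metric.ball q R) :=
        fun x hx => (hg x hx).continuousAt.continuousWithinAt
      exact h1.comp (e.continuousOn.mono inter_subset_left) fun z hz => hz.2
    · intro z hz hlt
      have := hgu (e z) hz.2 hlt
      rw [e.left_inv hz.1] at this
      exact max_eq_left (by linarith)
  refine ⟨w, isContPSH_of_touching hcont fun z => ?_, hin, hout⟩
  -- Where w equals u, the function u touches from below; elsewhere z lies in the chart ball and g
  -- touches.
  by_cases h : w z = u z
  · exact .inl ⟨u, hu, .of_forall hge, h⟩
  · have hz : z ∈ chartBall e q R := by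
      by_contra hz
      exact h (hout z hz)
    refine .inr ⟨e, he, hz.1, g, holSubmeanAt_of_leviForm_pos (hg _ hz.2) (hL _ hz.2), ?_, ?_⟩
    · filter_upwards [Metric.isOpen_ball.mem_nhds hz.2] with x hx
      have hxt : x ∈ e.target := hR (Metric.ball_subset_closedBall hx)
      have hx' : e.symm x ∈ chartBall e q R :=
        ⟨e.map_target hxt, by rwa [mem_preimage, e.right_inv hxt]⟩
      rw [hin _ hx', e.right_inv hxt]
      exact le_max_right _ _
    · rw [hin z hz] at h ⊢
      rcases max_choice (u z) (g (e z)) with h1 | h1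
      · exact absurd h1 h
      · exact h1

/-- Add c · dip(‖x − q‖² + ε), supported in ‖x − q‖ ≤ R/2. Its logarithmic part is plurisubharmonic,
and the loss −c‖x − q‖² is paid for by the Levi form of g. A small ε makes the dip as deep as
desired. -/
theorem IsContPSH.exists_dip {e : OpenPartialHomeomorph M (EuclideanSpace ℂ (Fin n))}
    (he : e ∈ atlas (EuclideanSpace ℂ (Fin n)) M) {q : EuclideanSpace ℂ (Fin n)} {R : ℝ}
    (hR0 : 0 < R) (hR : Metric.closedBall q R ⊆ e.target) {u : M → ℝ} (hu : IsContPSH n u)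
    {g : EuclideanSpace ℂ (Fin n) → ℝ} {c : ℝ} (hc : 0 < c)
    (hg : ∀ x ∈ Metric.ball q R, ContDiffAt ℝ 2 g x)
    (hL : ∀ x ∈ Metric.ball q R, ∀ v ≠ 0, c * ‖v‖ ^ 2 < leviForm g x v)
    (hgu : ∀ x ∈ Metric.ball q R, u (e.symm x) = g x) {L : ℝ} (hL0 : 0 ≤ L) :
    ∃ w, IsContPSH n w ∧ (∀ z, w z ≤ u z) ∧ (∀ z ∉ chartBall e q R, w z = u z) ∧
      w (e.symm q) ≤ u (e.symm q) - L := by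
  set s := R / 2 with hs
  have hs0 : 0 < s := by positivity
  have hsR : s < R := by linarith
  obtain ⟨ε, hε, hdip⟩ := exists_dip_small hs0 hc hL0
  set Y := s ^ 2 + ε with hY
  have hY0 : 0 < Y := by positivity
  have hy0 : ∀ x : EuclideanSpace ℂ (Fin n), 0 < ‖x - q‖ ^ 2 + ε := fun x => by positivity
  set w : M → ℝ := fun z =>
    u z + (chartBall e q R).indicator (fun z => c * dip Y (‖e z - q‖ ^ 2 + ε)) z with hw
  have hin : ∀ z ∈ chartBall e q R, w z = u z + c * dip Y (‖e z - q‖ ^ 2 + ε) := fun z hz => by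
    simp only [hw, indicator_of_mem hz]
  have hout : ∀ z ∉ chartBall e q R, w z = u z := fun z hz => by
    simp only [hw, indicator_of_notMem hz, add_zero]
  have hsymm : ∀ x ∈ Metric.ball q R, e.symm x ∈ chartBall e q R ∧ e (e.symm x) = x := by
    intro x hx
    have hxt : x ∈ e.target := hR (Metric.ball_subset_closedBall hx)
    exact ⟨⟨e.map_target hxt, by rwa [mem_preimage, e.right_inv hxt]⟩, e.right_inv hxt⟩
  have hfar : ∀ z ∈ chartBall e q R, s < dist (e z) q → c * dip Y (‖e z - q‖ ^ 2 + ε) = 0 := by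
    intro z _ hlt
    rw [dist_eq_norm] at hlt
    rw [dip_of_le hY0, mul_zero]
    have := pow_le_pow_left₀ hs0.le hlt.le 2
    linarith
  have hcont : Continuous w := by
    refine hu.cont.add (continuous_indicator_chartBall hR hsR ?_ hfar)
    refine ContinuousOn.const_mul ?_ c
    refine (continuousOn_dip hY0).comp (ContinuousOn.add ?_ continuousOn_const) fun z _ => hy0 (e z)
    exact ((e.continuousOn.mono inter_subset_left).sub continuousOn_const).norm.pow 2
  refine ⟨w, isContPSH_of_touching hcont fun z => ?_, fun z => ?_, hout, ?_⟩
  · by_cases hz : z ∈ chartBall e q R ∧ dist (e z) q ≤ s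
    · obtain ⟨hz, hzs⟩ := hz
      rw [dist_eq_norm] at hzs
      right
      set p := e z with hp
      -- The logarithm of ‖x − q‖² + ε is replaced by its pluriharmonic minorant 2 log ‖l x‖ −
      -- log(‖p − q‖² + ε), which touches it at x = p. The constant b collects what is needed for
      -- equality there.
      set l : EuclideanSpace ℂ (Fin n) → ℂ := fun x => inner ℂ (p - q) (x - q) + (ε : ℂ) with hl
      have hla : AnalyticAt ℂ l p := by
        have h1 : AnalyticAt ℂ (fun x : EuclideanSpace ℂ (Fin n) => innerSL ℂ (p - q) (x - q)) p :=
          (ContinuousLinearMap.analyticAt _ _).comp_of_eq (analyticAt_id.sub analyticAt_const) rfl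
        exact h1.add analyticAt_const
      have hlp : l p = ((‖p - q‖ ^ 2 + ε : ℝ) : ℂ) := by
        simp only [hl, inner_self_eq_norm_sq_to_K]
        push_cast
        rfl
      have hlp0 : l p ≠ 0 := by
        rw [hlp]
        exact_mod_cast (hy0 p).ne'
      set b := c * (-Y * Real.log (‖p - q‖ ^ 2 + ε) - Y * Real.log Y + Y - ε) with hb
      have hgp := hg p hz.2
      refine ⟨e, he, hz.1, fun x => (g x + (-c) * ‖x - q‖ ^ 2 + b) + 2 * c * Y * Real.log ‖l x‖,
        ?_, ?_, ?_⟩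
      · refine (holSubmeanAt_of_leviForm_pos (contDiffAt_add_norm_sq hgp q b (-c))
          fun v hv => ?_).add ((holSubmeanAt_log_norm hla hlp0).const_mul (by positivity))
        rw [leviForm_add_norm_sq hgp]
        linarith [hL p hz.2 v hv]
      · filter_upwards [Metric.isOpen_ball.mem_nhds hz.2, hla.continuousAt.eventually_ne hlp0]
          with x hx hlx
        obtain ⟨hx1, hx2⟩ := hsymm x hx
        rw [hin _ hx1, hgu x hx, hx2]
        have h1 := log_norm_inner_add_le hε (p - q) (x - q) hlx
        have h2 := mul_le_mul_of_nonneg_left h1 (mul_pos hc hY0).le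
        have h3 := mul_le_mul_of_nonneg_left (le_dip hY0 (hy0 x)) hc.le
        rw [hb]
        linarith
      · have h1 : u z = g p := by
          have := hgu p hz.2
          rwa [hp, e.left_inv hz.1] at this
        have h2 : ‖p - q‖ ^ 2 + ε ≤ Y := by
          have := pow_le_pow_left₀ (norm_nonneg _) hzs 2
          linarith
        beta_reduce
        rw [hin z hz, h1, ← hp, dip_of_ge hY0 (hy0 p) h2, hlp, Complex.norm_real,
          Real.norm_of_nonneg (hy0 p).le, hb]
        ring
    -- Such a z lies off the closed image of the ball of radius s, and on the complement of that
    -- image w coincides with u.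
    · left
      refine ⟨u, hu, ?_, ?_⟩
      · have hsub : Metric.closedBall q s ⊆ e.target :=
          (Metric.closedBall_subset_closedBall hsR.le).trans hR
        have hK : IsClosed (e.symm '' Metric.closedBall q s) :=
          ((isCompact_closedBall q s).image_of_continuousOn
            (e.continuousOn_symm.mono hsub)).isClosed
        have hzK : z ∉ e.symm '' Metric.closedBall q s := by
          rintro ⟨x, hx, rfl⟩
          obtain ⟨h1, h2⟩ := hsymm x (Metric.closedBall_subset_ball hsR hx)
          exact hz ⟨h1, by rw [h2]; exact hx⟩
        filter_upwards [hK.isOpen_compl.mem_nhds hzK] with y hy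
        by_cases hyN : y ∈ chartBall e q R
        · rw [hin y hyN, hfar y hyN, add_zero]
          exact lt_of_not_ge fun hle => hy ⟨e y, hle, e.left_inv hyN.1⟩
        · rw [hout y hyN]
      · by_cases hzN : z ∈ chartBall e q R
        · rw [hin z hzN, hfar z hzN, add_zero]
          exact lt_of_not_ge fun hle => hz ⟨hzN, hle⟩
        · exact hout z hzN
  · by_cases hz : z ∈ chartBall e q R
    · rw [hin z hz]
      have := mul_nonpos_of_nonneg_of_nonpos hc.le (dip_nonpos hY0 (hy0 (e z)))
      linarith
    · rw [hout z hz]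
  · obtain ⟨h1, h2⟩ := hsymm q (Metric.mem_ball_self hR0)
    rw [hin _ h1, h2, sub_self, norm_zero]
    simp only [ne_eq, OfNat.ofNat_ne_zero, not_false_eq_true, zero_pow, zero_add]
    linarith

end Glue

/-! ### Competitors separating points from A^{cb}(w₀), and the contradiction. -/

variable {n : ℕ} {M : Type*} [TopologicalSpace M] [ChartedSpace (EuclideanSpace ℂ (Fin n)) M]

theorem isClosed_Acb (w₀ : M) : IsClosed (Acb n w₀) := by
  have : Acb n w₀ = ⋂ u ∈ PSHcb n (M := M), {z | u z ≤ u w₀} := by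
    ext z
    simp [Acb]
  rw [this]
  exact isClosed_biInter fun u hu => isClosed_le hu.2.2 continuous_const

theorem IsContPSH.le_of_mem_Acb {w₀ : M} {u : M → ℝ} (hu : IsContPSH n u) {C : ℝ}
    (hC : ∀ z, u z ≤ C) {z : M} (hz : z ∈ Acb n w₀) : u z ≤ u w₀ :=
  EReal.coe_le_coe_iff.1 (hz _ (hu.mem_PSHcb hC))

/-- Truncate a separating function at a level a strictly between its values at w₀ and z, subtract a,
and multiply by a large constant. -/
theorem exists_isContPSH_gt_of_notMem_Acb {w₀ z : M} (hz : z ∉ Acb n w₀) (C : ℝ) :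
    ∃ u, IsContPSH n u ∧ (∃ B, ∀ y, u y ≤ B) ∧ (∀ y, 0 ≤ u y) ∧ u w₀ = 0 ∧ C < u z := by
  simp only [Acb, mem_ofPred_eq, not_forall, not_le] at hz
  obtain ⟨f, hf, hlt⟩ := hz
  obtain ⟨a, ha1, ha2⟩ := EReal.lt_iff_exists_real_btwn.1 hlt
  obtain ⟨B, hB⟩ := hf.1.2
  have hg := isContPSH_toReal_max hf a
  set g : M → ℝ := fun z => (max (f z) a).toReal with hgdef
  have htop : ∀ z, max (f z) a ≠ ⊤ := fun z =>
    ((max_lt_iff.2 ⟨(hB z).trans_lt (EReal.coe_lt_top _), EReal.coe_lt_top _⟩)).ne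
  have hbot : ∀ z, max (f z) a ≠ ⊥ := fun z =>
    ((EReal.bot_lt_coe a).trans_le (le_max_right _ _)).ne'
  have hco : ∀ z, ((g z : ℝ) : EReal) = max (f z) a := fun z => EReal.coe_toReal (htop z) (hbot z)
  have h0 : g w₀ = a := by
    rw [← EReal.coe_eq_coe_iff, hco, max_eq_right ha1.le]
  have h1 : a < g z := by
    rw [← EReal.coe_lt_coe_iff, hco]
    exact lt_max_of_lt_left ha2
  have hge : ∀ y, a ≤ g y := fun y => by
    rw [← EReal.coe_le_coe_iff, hco]
    exact le_max_right _ _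
  have hle : ∀ y, g y ≤ max B a := fun y => by
    rw [← EReal.coe_le_coe_iff, hco]
    exact max_le ((hB y).trans (EReal.coe_le_coe_iff.2 (le_max_left _ _)))
      (EReal.coe_le_coe_iff.2 (le_max_right _ _))
  have hpos : 0 < g z - a := by linarith
  set t := (|C| + 1) / (g z - a) with ht
  have ht0 : 0 ≤ t := by positivity
  refine ⟨fun y => t * g y + -(t * a), hg.affine ht0 _, ⟨t * max B a + -(t * a), fun y => ?_⟩,
    fun y => ?_, ?_, ?_⟩
  · have := mul_le_mul_of_nonneg_left (hle y) ht0
    linarith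
  · have := mul_le_mul_of_nonneg_left (hge y) ht0
    linarith
  · simp [h0]
  · have h2 : t * g z + -(t * a) = |C| + 1 := by
      rw [← sub_eq_add_neg, ← mul_sub, ht, div_mul_cancel₀ _ hpos.ne']
    simp only [h2]
    linarith [le_abs_self C]

/-- The bound C < u persists near each point, and maxima of finitely many such functions keep all
the normalizations. -/
theorem exists_isContPSH_gt_of_isCompact {w₀ : M} {K : Set M} (hK : IsCompact K)
    (hKA : ∀ z ∈ K, z ∉ Acb n w₀) (C : ℝ) :
    ∃ u, IsContPSH n u ∧ (∃ B, ∀ y, u y ≤ B) ∧ (∀ y, 0 ≤ u y) ∧ u w₀ = 0 ∧ ∀ z ∈ K, C < u z := by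
  refine hK.induction_on (p := fun S => ∃ u, IsContPSH n u ∧ (∃ B, ∀ y, u y ≤ B) ∧ (∀ y, 0 ≤ u y) ∧
    u w₀ = 0 ∧ ∀ z ∈ S, C < u z) ?_ ?_ ?_ ?_
  · exact ⟨fun _ => 0, isContPSH_const 0, ⟨0, fun _ => le_rfl⟩, fun _ => le_rfl, rfl, by simp⟩
  · rintro S T hST ⟨u, h1, h2, h3, h4, h5⟩
    exact ⟨u, h1, h2, h3, h4, fun z hz => h5 z (hST hz)⟩
  · rintro S T ⟨u, h1, ⟨B, h2⟩, h3, h4, h5⟩ ⟨u', h1', ⟨B', h2'⟩, h3', h4', h5'⟩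
    refine ⟨_, h1.sup h1', ⟨max B B', fun y => max_le_max (h2 y) (h2' y)⟩,
      fun y => (h3 y).trans (le_max_left _ _), by simp [h4, h4'], ?_⟩
    rintro z (hz | hz)
    · exact (h5 z hz).trans_le (le_max_left _ _)
    · exact (h5' z hz).trans_le (le_max_right _ _)
  · intro z hz
    obtain ⟨u, h1, h2, h3, h4, h5⟩ := exists_isContPSH_gt_of_notMem_Acb (hKA z hz) C
    exact ⟨{y | C < u y}, mem_nhdsWithin_of_mem_nhds
      ((isOpen_lt continuous_const h1.cont).mem_nhds h5), u, h1, h2, h3, h4, fun y hy => hy⟩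

variable [T2Space M] [IsManifold 𝓘(ℂ, EuclideanSpace ℂ (Fin n)) ω M]

/-- No strictly plurisubharmonic function near `z₀ ∈ A` has a local maximum on `A = A^{cb}(w₀)` at
`z₀`, provided that `A` has a point other than `w₀`. -/
theorem exists_gt_of_mem_Acb {w₀ : M} (hw₀ : Acb n w₀ ≠ {w₀}) {z₀ : M} (hz₀ : z₀ ∈ Acb n w₀)
    {V : Set M} (hV : IsOpen V) (hzV : z₀ ∈ V) {ρ : M → ℝ} (hρ : StrictPSHOn n ρ V) {U : Set M}
    (hU : U ∈ 𝓝 z₀) : ∃ z ∈ Acb n w₀ ∩ U, ρ z₀ < ρ z := by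
  by_contra! hmax
  have hwA : w₀ ∈ Acb n w₀ := fun u _ => le_rfl
  -- The comparison point is w₀ itself unless z₀ = w₀; only then is a second point of A required.
  obtain ⟨p, hpA, hpz, hp⟩ : ∃ p ∈ Acb n w₀, p ≠ z₀ ∧ (z₀ ≠ w₀ → p = w₀) := by
    by_cases h : z₀ = w₀
    · by_contra! hcon
      refine hw₀ (Subset.antisymm (fun y hy => ?_) (singleton_subset_iff.2 hwA))
      by_contra hne
      exact absurd (hcon y hy (by rw [h]; exact hne)).1 (by simp [h])
    · exact ⟨w₀, hwA, fun h' => h h'.symm, fun _ => rfl⟩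
  set e := chartAt (EuclideanSpace ℂ (Fin n)) z₀
  have he : e ∈ atlas (EuclideanSpace ℂ (Fin n)) M := chart_mem_atlas _ _
  have hzs : z₀ ∈ e.source := mem_chart_source _ _
  set q := e z₀
  have hqt : q ∈ e.target := e.map_source hzs
  have hqz : e.symm q = z₀ := e.left_inv hzs
  set G : EuclideanSpace ℂ (Fin n) → ℝ := ρ ∘ e.symm with hG
  set Ω := e.target ∩ e.symm ⁻¹' V
  have hΩ : IsOpen Ω := e.isOpen_inter_preimage_symm hV
  have hqΩ : q ∈ Ω := ⟨hqt, by rwa [mem_preimage, hqz]⟩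
  have hGs : IsStrictPSHOn G Ω := hρ e he
  obtain ⟨c, hc, hlevi⟩ := hGs.exists_leviForm_lower_bound hΩ hqΩ
  have hev : ∀ᶠ x in 𝓝 q, (x ∈ Ω ∧ e.symm x ∈ U ∧ e.symm x ≠ p) ∧
      ∀ v ≠ 0, c * ‖v‖ ^ 2 < leviForm G x v := by
    have ht : Tendsto e.symm (𝓝 q) (𝓝 z₀) := by
      have := e.symm.continuousAt (x := q) hqt
      rwa [ContinuousAt, hqz] at this
    exact ((hΩ.eventually_mem hqΩ).and
      ((ht.eventually hU).and (ht.eventually_ne hpz.symm))).and hlevi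
  obtain ⟨R, hR0, hR⟩ := Metric.nhds_basis_closedBall.eventually_iff.1 hev
  -- Half of the Levi bound c pays for −k‖x − q‖²; the other half remains as the bound k for g that
  -- the dip consumes.
  set k := c / 2 with hk
  have hk0 : 0 < k := by positivity
  -- On A at distance at least R/2 from q this gives g ≤ δ − kR²/4 = −kR²/8 < 0.
  set δ := k * R ^ 2 / 8 with hδ
  have hδ0 : 0 < δ := by positivity
  set g : EuclideanSpace ℂ (Fin n) → ℝ := fun x => G x + (-k) * ‖x - q‖ ^ 2 + (δ - G q) with hg
  have hGc : ∀ x ∈ Metric.closedBall q R, ContDiffAt ℝ 2 G x := fun x hx =>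
    hGs.1.contDiffAt (hΩ.mem_nhds (hR hx).1.1)
  have hgc : ∀ x ∈ Metric.closedBall q R, ContDiffAt ℝ 2 g x := fun x hx =>
    contDiffAt_add_norm_sq (hGc x hx) _ _ _
  have hgL : ∀ x ∈ Metric.closedBall q R, ∀ v ≠ 0, k * ‖v‖ ^ 2 < leviForm g x v := by
    intro x hx v hv
    rw [leviForm_add_norm_sq (hGc x hx)]
    have := (hR hx).2 v hv
    rw [hk] at *
    linarith
  have hgL0 : ∀ x ∈ Metric.closedBall q R, ∀ v ≠ 0, 0 < leviForm g x v := fun x hx v hv =>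
    (by positivity : (0 : ℝ) ≤ k * ‖v‖ ^ 2).trans_lt (hgL x hx v hv)
  have hgcont : ContinuousOn g (Metric.closedBall q R) := fun x hx =>
    (hgc x hx).continuousAt.continuousWithinAt
  have hgq : g q = δ := by simp [hg]
  have htar : Metric.closedBall q R ⊆ e.target := fun x hx => (hR hx).1.1.1
  obtain ⟨B₁, hB₁⟩ := ((isCompact_closedBall q R).image_of_continuousOn hgcont).bddAbove
  replace hB₁ : ∀ x ∈ Metric.closedBall q R, g x ≤ B₁ := fun x hx => hB₁ ⟨x, hx, rfl⟩
  set S := (Metric.closedBall q R ∩ g ⁻¹' Ici 0) ∩ {x | R / 2 ≤ dist x q} with hS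
  have hScomp : IsCompact S := by
    refine IsCompact.inter_right ?_ (isClosed_le continuous_const (by fun_prop))
    exact (isCompact_closedBall q R).of_isClosed_subset
      (hgcont.preimage_isClosed_of_isClosed Metric.isClosed_closedBall isClosed_Ici)
      inter_subset_left
  have hK : IsCompact (e.symm '' S) := hScomp.image_of_continuousOn
    (e.continuousOn_symm.mono fun x hx => htar hx.1.1)
  have hKA : ∀ z ∈ e.symm '' S, z ∉ Acb n w₀ := by
    rintro _ ⟨x, ⟨⟨hx, hgx⟩, hxr⟩, rfl⟩ hxA
    have h1 := hmax _ ⟨hxA, (hR hx).1.2.1⟩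
    have h2 : G x ≤ G q := by simpa [hG, hqz] using h1
    have h3 : (0 : ℝ) ≤ g x := hgx
    simp only [mem_ofPred_eq, dist_eq_norm] at hxr
    have h4 := mul_le_mul_of_nonneg_left (pow_le_pow_left₀ (by positivity) hxr 2) hk0.le
    simp only [hg, hδ] at h3
    nlinarith [mul_pos hk0 (pow_pos hR0 2)]
  obtain ⟨u, hu, ⟨B, hB⟩, hu0, huw, huK⟩ := exists_isContPSH_gt_of_isCompact hK hKA B₁
  -- On A the definition gives u ≤ u(w₀) = 0, and u ≥ 0 everywhere.
  have huA : ∀ z ∈ Acb n w₀, u z = 0 := fun z hz =>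
    le_antisymm ((hu.le_of_mem_Acb hB hz).trans_eq huw) (hu0 z)
  have hbc : ∀ x ∈ Metric.ball q R, x ∈ Metric.closedBall q R := fun x hx =>
    Metric.ball_subset_closedBall hx
  obtain ⟨v, hv, hvin, hvout⟩ := hu.exists_glue_max he htar (half_lt_self hR0)
    (fun x hx => hgc x (hbc x hx)) (fun x hx => hgL0 x (hbc x hx)) (by
      intro x hx hlt
      rcases lt_or_ge (g x) 0 with h | h
      · exact h.le.trans (hu0 _)
      · exact (hB₁ x (hbc x hx)).trans (huK _ ⟨x, ⟨⟨hbc x hx, h⟩, hlt.le⟩, rfl⟩).le)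
  have hvB : ∀ z, v z ≤ max B B₁ := fun z => by
    by_cases hz : z ∈ chartBall e q R
    · rw [hvin z hz]
      exact max_le_max (hB z) (hB₁ _ (hbc _ hz.2))
    · rw [hvout z hz]
      exact (hB z).trans (le_max_left _ _)
  have hpN : p ∉ chartBall e q R := fun h => (hR (hbc _ h.2)).1.2.2 (e.left_inv h.1)
  have hvp : v p = 0 := by rw [hvout p hpN, huA p hpA]
  have hzN : z₀ ∈ chartBall e q R := ⟨hzs, Metric.mem_ball_self hR0⟩
  have hvz : v z₀ = δ := by
    rw [hvin z₀ hzN, huA z₀ hz₀, hgq, max_eq_right hδ0.le]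
  by_cases hzw : z₀ = w₀
  · have hlt : ∀ᶠ x in 𝓝 q, u (e.symm x) < g x := by
      have h1 : ContinuousAt (fun x => u (e.symm x)) q :=
        hu.cont.continuousAt.comp (e.symm.continuousAt (x := q) hqt)
      refine h1.eventually_lt (hgc q (Metric.mem_closedBall_self hR0.le)).continuousAt ?_
      rw [hqz, huA z₀ hz₀, hgq]
      exact hδ0
    obtain ⟨s, hs0, hs⟩ := Metric.nhds_basis_ball.eventually_iff.1
      (hlt.and (Metric.ball_mem_nhds q hR0))
    have hsR : ∀ x ∈ Metric.ball q (s / 2), u (e.symm x) < g x ∧ x ∈ Metric.ball q R := fun x hx =>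
      hs (Metric.ball_subset_ball (by linarith) hx)
    -- Depth δ + 1 brings the value δ at z₀ down to at most −1, below w(p) = 0.
    obtain ⟨w, hw, hwv, hwout, hwq⟩ := hv.exists_dip he (g := g) (half_pos hs0)
      (fun x hx => htar (hbc x (hs (Metric.closedBall_subset_ball (half_lt_self hs0) hx)).2)) hk0
      (fun x hx => hgc x (hbc x (hsR x hx).2)) (fun x hx => hgL x (hbc x (hsR x hx).2))
      (fun x hx => by
        obtain ⟨h1, h2⟩ := hsR x hx
        have hxt := htar (hbc x h2)
        rw [hvin _ ⟨e.map_target hxt, by rwa [mem_preimage, e.right_inv hxt]⟩, e.right_inv hxt,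
          max_eq_right h1.le]) (L := δ + 1) (by positivity)
    have h1 := hw.le_of_mem_Acb (fun z => (hwv z).trans (hvB z)) hpA
    have hpN' : p ∉ chartBall e q (s / 2) := fun h => hpN ⟨h.1, (hsR _ h.2).2⟩
    rw [hwout p hpN', hvp, ← hzw] at h1
    rw [hqz, hvz] at hwq
    linarith
  · have h1 := hv.le_of_mem_Acb hvB hz₀
    rw [← hp hzw, hvp, hvz] at h1
    linarith

end CplxMfd

theorem theorem4p1 (n : ℕ) {M : Type*} [TopologicalSpace M] [T2Space M]
    [ChartedSpace (EuclideanSpace ℂ (Fin n)) M]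
    [IsManifold 𝓘(ℂ, EuclideanSpace ℂ (Fin n)) ω M]
    (w₀ : M) (hw₀ : CplxMfd.Acb n w₀ ≠ {w₀}) :
    CplxMfd.IsRothsteinPseudoconcave n (CplxMfd.Acb n w₀) :=
  ⟨CplxMfd.isClosed_Acb w₀, fun _ hz₀ _ hV hzV _ hρ _ hU _ _ =>
    CplxMfd.exists_gt_of_mem_Acb hw₀ hz₀ hV hzV hρ hU⟩
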